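/- Let $B$ be a unital C*-algebra, let $\{A_i\}_{i\in I}$ be a family of unital C*-algebras, and let $\varepsilon_i : B\to A_i$ be injective unital $*$-homomorphisms, by which $B$ is regarded as a common unital C*-subalgebra of the $A_i$. Let $\ast_B A_i$ be the amalgamated free product C*-algebra: the completion of the $*$-algebraic amalgamated free product of the $A_i$ over $B$ in the seminorm $\|x\|=\sup_\pi\|\pi(x)\|$, where $\pi$ runs over its $*$-representations on Hilbert spaces. Suppose that for every $j$ in a subset $J\subset I$ there is given a conditional expectation $E_j$ of $A_j$ onto $B$, i.e. a positive linear $B$-bimodule map $E_j:A_j\to B$ with $E_j\circ\varepsilon_j=\mathrm{id}_B$. Let $H$ be a Hilbert space and let $\Phi_i : A_i\to\mathcal B(H)$, $i\in I$, be unital completely positive maps which restrict to a common $*$-representation $\rho$ of $B$, i.e. $\Phi_i\circ\varepsilon_i=\rho$ for all $i\in I$. Then there is a unital completely positive map $\Phi:\ast_B A_i\to\mathcal B(H)$ such that $\Phi|_{A_i}=\Phi_i$ for all $i\in I$ and $$\Phi(a_n\cdots a_1)=\Phi_{j_n}(a_n)\cdots\Phi_{j_1}(a_1)$$ for all $n\ge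 1$, all $j_1,\dots,j_n\in J$ with $j_k\ne j_{k+1}$ for $1\le k<n$, and all $a_k\in\ker E_{j_k}\subset A_{j_k}$. -/

import Mathlib

open scoped ENNReal CStarAlgebra

universe u

/-- A conditional expectation of a unital C⋆-algebra `A` onto a unital C⋆-subalgebra `B`, the
inclusion being given by `ε : B → A`: a positive linear map `E : A → B` which restricts to the
identity on `B` and is a `B`-bimodule map. -/
structure ConditionalExpectation {A B : Type u} [CStarAlgebra A] [PartialOrder A]
    [StarOrderedRing A] [CStarAlgebra B] [PartialOrder B] [StarOrderedRing B]
    (ε : B →⋆ₐ[ℂ] A) extends A →ₗ[ℂ] B where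
  nonneg' : ∀ a, 0 ≤ a → 0 ≤ toFun a
  map_incl' : ∀ b, toFun (ε b) = b
  map_incl_mul' : ∀ b a, toFun (ε b * a) = b * toFun a
  map_mul_incl' : ∀ a b, toFun (a * ε b) = toFun a * b

/-- C⋆-algebra structure on the bounded elements of a product of (nonzero) C⋆-algebras. -/
noncomputable instance lpInftyCStarAlgebra {R : Type*} {C : R → Type*} [∀ r, Nontrivial (C r)]
    [∀ r, CStarAlgebra (C r)] : CStarAlgebra (lp C ∞) where

section FreeProduct

variable {I : Type u} {B : Type u} [CStarAlgebra B] {A : I → Type u} [∀ i, CStarAlgebra (A i)]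

/-- A unital ⋆-representation, on a nonzero Hilbert space, of the ⋆-algebraic amalgamated free
product of the `A i` over `B`: a family of unital ⋆-representations of the `A i` which agree on
`B`. The field `base` is their common restriction to `B`; it is determined by the other data as
soon as `I` is nonempty. (Representations on the zero space do not contribute to the norm.) -/
structure AmalgRep (ε : ∀ i, B →⋆ₐ[ℂ] A i) : Type (u + 1) where
  space : Type u
  [normed : NormedAddCommGroup space]
  [inner : InnerProductSpace ℂ space]
  [complete : CompleteSpace space]
  [nontrivial : Nontrivial space]
  base : B →⋆ₐ[ℂ] (space →L[ℂ] space)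
  rep : ∀ i, A i →⋆ₐ[ℂ] (space →L[ℂ] space)
  rep_incl : ∀ i b, rep i (ε i b) = base b

attribute [instance] AmalgRep.normed AmalgRep.inner AmalgRep.complete AmalgRep.nontrivial

/-- The bounded elements of the product of all `B(H_π)`, where `π` ranges over the representations
of the ⋆-algebraic amalgamated free product, with the norm `‖x‖ = sup_π ‖x π‖`. -/
abbrev AmalgAmbient (ε : ∀ i, B →⋆ₐ[ℂ] A i) : Type (u + 1) :=
  lp (fun π : AmalgRep ε => π.space →L[ℂ] π.space) ∞

/-- The ⋆-homomorphism into the product assembled from ⋆-homomorphisms into all factors. -/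
noncomputable def AmalgAmbient.ofFamily {ε : ∀ i, B →⋆ₐ[ℂ] A i} {D : Type u} [CStarAlgebra D]
    (f : ∀ π : AmalgRep ε, D →⋆ₐ[ℂ] (π.space →L[ℂ] π.space)) : D →⋆ₐ[ℂ] AmalgAmbient ε where
  toFun a := ⟨fun π => f π a, memℓp_infty ⟨‖a‖, by
    rintro _ ⟨π, rfl⟩
    exact NonUnitalStarAlgHom.norm_apply_le (f π) a⟩⟩
  map_one' := by ext1; funext π; exact map_one (f π)
  map_mul' a b := by ext1; funext π; exact map_mul (f π) a b
  map_zero' := by ext1; funext π; exact map_zero (f π)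
  map_add' a b := by ext1; funext π; exact map_add (f π) a b
  commutes' c := by ext1; funext π; exact AlgHomClass.commutes (f π) c
  map_star' a := by ext1; funext π; exact map_star (f π) a

/-- The element `a` of `A i` in the universal representation. -/
noncomputable def AmalgAmbient.incl (ε : ∀ i, B →⋆ₐ[ℂ] A i) (i : I) : A i →⋆ₐ[ℂ] AmalgAmbient ε :=
  AmalgAmbient.ofFamily fun π => π.rep i

/-- The element `b` of `B` in the universal representation. -/
noncomputable def AmalgAmbient.baseIncl (ε : ∀ i, B →⋆ₐ[ℂ] A i) : B →⋆ₐ[ℂ] AmalgAmbient ε :=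
  AmalgAmbient.ofFamily fun π => π.base

/-- The image of the ⋆-algebraic amalgamated free product in its universal representation: the
⋆-algebra generated by the images of `B` and of all the `A i`. (The image of `B` lies in that of
each `A i`; it is listed so that the free product of the empty family is `B`.) -/
noncomputable def AmalgAmbient.algebraic (ε : ∀ i, B →⋆ₐ[ℂ] A i) :
    StarSubalgebra ℂ (AmalgAmbient ε) :=
  StarAlgebra.adjoin ℂ
    (Set.range (AmalgAmbient.baseIncl ε) ∪ ⋃ i, Set.range (AmalgAmbient.incl ε i))

/-- The amalgamated free product C⋆-algebra of the `A i` over `B`: the (Hausdorff) completion of the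
⋆-algebraic amalgamated free product in the seminorm `‖x‖ = sup ‖π(x)‖`, the supremum over all of
its ⋆-representations `π`. It is realized as the norm closure of the image of the ⋆-algebraic free
product in the direct sum of all these representations. -/
def AmalgFreeProduct (ε : ∀ i, B →⋆ₐ[ℂ] A i) : Type (u + 1) :=
  (AmalgAmbient.algebraic ε).topologicalClosure

namespace AmalgFreeProduct

variable (ε : ∀ i, B →⋆ₐ[ℂ] A i)

noncomputable instance : CStarAlgebra (AmalgFreeProduct ε) :=
  haveI : IsClosed ((AmalgAmbient.algebraic ε).topologicalClosure : Set (AmalgAmbient ε)) :=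
    (AmalgAmbient.algebraic ε).isClosed_topologicalClosure
  inferInstanceAs (CStarAlgebra (AmalgAmbient.algebraic ε).topologicalClosure)

noncomputable instance : PartialOrder (AmalgFreeProduct ε) := CStarAlgebra.spectralOrder _

instance : StarOrderedRing (AmalgFreeProduct ε) := CStarAlgebra.spectralOrderedRing _

/-- The canonical ⋆-homomorphism `A i → AmalgFreeProduct ε`. -/
noncomputable def of (i : I) : A i →⋆ₐ[ℂ] AmalgFreeProduct ε :=
  StarAlgHom.codRestrict (AmalgAmbient.incl ε i) (AmalgAmbient.algebraic ε).topologicalClosure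
    fun a => (AmalgAmbient.algebraic ε).le_topologicalClosure
      (StarAlgebra.subset_adjoin ℂ _ (Or.inr (Set.mem_iUnion.2 ⟨i, a, rfl⟩)))

/-- The canonical ⋆-homomorphism `B → AmalgFreeProduct ε`. -/
noncomputable def ofBase : B →⋆ₐ[ℂ] AmalgFreeProduct ε :=
  StarAlgHom.codRestrict (AmalgAmbient.baseIncl ε) (AmalgAmbient.algebraic ε).topologicalClosure
    fun b => (AmalgAmbient.algebraic ε).le_topologicalClosure
      (StarAlgebra.subset_adjoin ℂ _ (Or.inl ⟨b, rfl⟩))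

theorem of_incl (i : I) (b : B) : of ε i (ε i b) = ofBase ε b :=
  Subtype.ext <| Subtype.ext <| funext fun π => π.rep_incl i b

/-- A representation of the ⋆-algebraic free product extends to the C⋆-algebra: it is a coordinate
of the universal representation. -/
noncomputable def eval (π : AmalgRep ε) :
    AmalgFreeProduct ε →⋆ₐ[ℂ] (π.space →L[ℂ] π.space) where
  toFun x := x.1.1 π
  map_one' := rfl
  map_mul' _ _ := rfl
  map_zero' := rfl
  map_add' _ _ := rfl
  commutes' _ := rfl
  map_star' _ := rfl

/-- The norm is the supremum of the norms in all representations. -/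
theorem norm_eq_iSup (x : AmalgFreeProduct ε) : ‖x‖ = ⨆ π : AmalgRep ε, ‖eval ε π x‖ :=
  lp.norm_eq_ciSup x.1

/-- The universal property: unital ⋆-representations of the `A i` on a Hilbert space which agree on
`B` lift to a ⋆-representation of the amalgamated free product. -/
theorem exists_lift {H : Type u} [NormedAddCommGroup H] [InnerProductSpace ℂ H] [CompleteSpace H]
    [Nontrivial H] (σ : B →⋆ₐ[ℂ] (H →L[ℂ] H)) (ψ : ∀ i, A i →⋆ₐ[ℂ] (H →L[ℂ] H))
    (h : ∀ i b, ψ i (ε i b) = σ b) :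
    ∃ τ : AmalgFreeProduct ε →⋆ₐ[ℂ] (H →L[ℂ] H),
      (∀ i a, τ (of ε i a) = ψ i a) ∧ ∀ b, τ (ofBase ε b) = σ b :=
  ⟨eval ε ⟨H, σ, ψ, h⟩, fun _ _ => rfl, fun _ => rfl⟩

end AmalgFreeProduct

end FreeProduct

/-! Boca's theorem is proved by building one Hilbert space `K` that contains the given space `V₀`
and carries representations of all the `A i` agreeing on `B`. The universal property gives a
representation of the free product on `K`, and its compression to `V₀` is the required map.

The building block is a `RepDilation`: from a representation `V` of `B` it makes a representation of
`A i` on `V ⊕ V'`, with `B` acting diagonally. Three sources are used. Stinespring's theorem dilates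
`V₀` so that the corner of `A i` on `V₀` is `Φ i`. For `j ∈ J`, any `V` has a dilation whose corner
kills the kernel of `E j`. For every other index, any `V` has some dilation, because positive
functionals extend from `B` to `A i`.

Iterating yields a tree of representations of `B` indexed by words. The node `i :: w` is the
complement `V'` in the `i`-dilation of the node `w`. Let `K` be the Hilbert sum over reduced words.
For fixed `i`, the pairs `(y, i :: y)`, with `y` not beginning with `i`, partition the reduced
words, so `A i` acts on `K` pair by pair. All these actions restrict to the diagonal action of `B`
(`exists_free_rep`).

Now apply a reduced product of elements of the kernels to a vector at the root. Each factor acts on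
the root component by `Φ`. Every other component lies at a word beginning with the previous letter,
and the vanishing corner pushes it to a longer word, so it never returns to the root
(`free_rep_prod_apply`). The root component of the result is therefore the product of the `Φ`. -/

section AmalgamatedDilation

open scoped ComplexOrder InnerProductSpace

/-! ### Representations from positive kernels (GNS construction). -/

/-- A ⋆-representation of a unital C⋆-algebra on a Hilbert space. -/
structure HilbertRep (A : Type u) [CStarAlgebra A] : Type (u + 1) where
  space : Type u
  [normed : NormedAddCommGroup space]
  [inner : InnerProductSpace ℂ space]
  [complete : CompleteSpace space]
  rep : A →⋆ₐ[ℂ] (space →L[ℂ] space)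

attribute [instance] HilbertRep.normed HilbertRep.inner HilbertRep.complete

theorem HilbertRep.inner_rep_left {A : Type u} [CStarAlgebra A] (V : HilbertRep A) (a : A)
    (x y : V.space) : ⟪V.rep a x, y⟫_ℂ = ⟪x, V.rep (star a) y⟫_ℂ := by
  rw [map_star, ContinuousLinearMap.star_eq_adjoint, ContinuousLinearMap.adjoint_inner_right]

theorem HilbertRep.inner_rep_right {A : Type u} [CStarAlgebra A] (V : HilbertRep A) (a : A)
    (x y : V.space) : ⟪x, V.rep a y⟫_ℂ = ⟪V.rep (star a) x, y⟫_ℂ := by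
  rw [V.inner_rep_left, star_star]

/-- A positive definite kernel on `X` with values in the linear functionals on `A`. -/
structure PositiveKernel (X A : Type u) [CStarAlgebra A] where
  ker : X → X → A →ₗ[ℂ] ℂ
  ker_star : ∀ s t a, ker s t (star a) = star (ker t s a)
  nonneg : ∀ x : X →₀ A, 0 ≤ x.sum fun s a => x.sum fun t b => ker s t (star a * b)

namespace PositiveKernel

variable {X A : Type u} [CStarAlgebra A] (k : PositiveKernel X A)

/-- The space of finitely supported `A`-valued functions on `X`, which carries the semi-inner
product given by the kernel. -/
def Pre (_k : PositiveKernel X A) : Type u := X →₀ A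

noncomputable instance : AddCommGroup k.Pre := inferInstanceAs (AddCommGroup (X →₀ A))
noncomputable instance : Module ℂ k.Pre := inferInstanceAs (Module ℂ (X →₀ A))

/-- The identification of `k.Pre` with the functions of finite support. -/
noncomputable def toPre : (X →₀ A) ≃ₗ[ℂ] k.Pre := LinearEquiv.refl ℂ _

/-- The semi-inner product given by the kernel. -/
noncomputable def form (x y : X →₀ A) : ℂ :=
  x.sum fun s a => y.sum fun t b => k.ker s t (star a * b)

theorem form_add_left (x y z : X →₀ A) : k.form (x + y) z = k.form x z + k.form y z := by
  classical
  unfold form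
  refine Finsupp.sum_add_index' (fun s => ?_) fun s a b => ?_
  · simp
  · simp [add_mul, Finsupp.sum_add]

theorem form_smul_left (c : ℂ) (x z : X →₀ A) : k.form (c • x) z = star c * k.form x z := by
  unfold form
  rw [Finsupp.sum_smul_index' (fun s => by simp)]
  simp [Finsupp.mul_sum]

theorem form_add_right (x y z : X →₀ A) : k.form x (y + z) = k.form x y + k.form x z := by
  classical
  unfold form
  rw [← Finsupp.sum_add]
  refine Finsupp.sum_congr fun s _ => Finsupp.sum_add_index' (fun s => ?_) fun s a b => ?_
  · simp
  · simp [mul_add]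

theorem form_conj (x y : X →₀ A) : star (k.form y x) = k.form x y := by
  unfold form
  rw [Finsupp.sum_comm]
  simp only [Finsupp.sum, star_sum]
  refine Finset.sum_congr rfl fun s _ => Finset.sum_congr rfl fun t _ => ?_
  rw [← k.ker_star, star_mul, star_star]

theorem form_smul_right (c : ℂ) (x z : X →₀ A) : k.form x (c • z) = c * k.form x z := by
  rw [← k.form_conj, form_smul_left, star_mul, star_star, k.form_conj, mul_comm]

theorem form_self_nonneg (x : X →₀ A) : 0 ≤ k.form x x := k.nonneg x

theorem form_single (s t : X) (a b : A) :
    k.form (Finsupp.single s a) (Finsupp.single t b) = k.ker s t (star a * b) := by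
  simp [form]

/-- Pointwise left multiplication. -/
noncomputable def lmul (a : A) : (X →₀ A) →ₗ[ℂ] (X →₀ A) :=
  Finsupp.mapRange.linearMap (LinearMap.mulLeft ℂ a)

theorem lmul_single (a : A) (s : X) (b : A) :
    lmul a (Finsupp.single s b) = Finsupp.single s (a * b) := by
  simp [lmul]

theorem lmul_apply (a : A) (x : X →₀ A) (s : X) : lmul a x s = a * x s := rfl

theorem lmul_mul (a b : A) (x : X →₀ A) : lmul (a * b) x = lmul a (lmul b x) := by
  ext s; simp [lmul_apply, mul_assoc]

theorem lmul_add (a b : A) (x : X →₀ A) : lmul (a + b) x = lmul a x + lmul b x := by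
  ext s; simp [lmul_apply, add_mul]

theorem lmul_smul (c : ℂ) (a : A) (x : X →₀ A) : lmul (c • a) x = c • lmul a x := by
  ext s; simp [lmul_apply]

theorem lmul_one (x : X →₀ A) : lmul (1 : A) x = x := by
  ext s; simp [lmul_apply]

theorem form_lmul (a : A) (x y : X →₀ A) : k.form (lmul a x) y = k.form x (lmul (star a) y) := by
  unfold form lmul
  simp only [Finsupp.mapRange.linearMap_apply]
  rw [Finsupp.sum_mapRange_index (fun s => by simp)]
  refine Finsupp.sum_congr fun s _ => ?_
  rw [Finsupp.sum_mapRange_index (fun s => by simp)]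
  simp [mul_assoc]

/-- Since `‖a‖² - a⋆a` is positive, it equals `c⋆c`. The gap between the two sides is then the
square seminorm of `lmul c x`. This makes left multiplication bounded. -/
theorem form_lmul_self_le [PartialOrder A] [StarOrderedRing A] (a : A) (x : X →₀ A) :
    k.form (lmul a x) (lmul a x) ≤ (‖a‖ ^ 2 : ℝ) * k.form x x := by
  have h : 0 ≤ algebraMap ℝ A (‖a‖ ^ 2) - star a * a := by
    rw [sub_nonneg, sq, ← CStarRing.norm_star_mul_self]
    exact IsSelfAdjoint.le_algebraMap_norm_self (IsSelfAdjoint.star_mul_self a)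
  obtain ⟨c, hc⟩ := CStarAlgebra.nonneg_iff_eq_star_mul_self.mp h
  have h1 := k.form_self_nonneg (lmul c x)
  have h2 : lmul (star a * a) x + lmul (star c * c) x = ((‖a‖ ^ 2 : ℝ) : ℂ) • x := by
    rw [← lmul_add, ← hc, add_sub_cancel, Algebra.algebraMap_eq_smul_one, ← Complex.coe_smul,
      lmul_smul, lmul_one]
  rw [form_lmul, ← lmul_mul] at h1 ⊢
  rw [← form_smul_right, ← h2, form_add_right]
  exact le_add_of_nonneg_right h1

/-- The semi-inner product space of a positive kernel. -/
noncomputable abbrev preCore : PreInnerProductSpace.Core ℂ k.Pre where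
  inner x y := k.form (k.toPre.symm x) (k.toPre.symm y)
  conj_inner_symm _ _ := k.form_conj _ _
  re_inner_nonneg x := (RCLike.nonneg_iff.mp (k.form_self_nonneg (k.toPre.symm x))).1
  add_left _ _ _ := k.form_add_left _ _ _
  smul_left _ _ _ := k.form_smul_left _ _ _

noncomputable instance : SeminormedAddCommGroup k.Pre :=
  InnerProductSpace.Core.toSeminormedAddCommGroup (c := k.preCore)

noncomputable instance : InnerProductSpace ℂ k.Pre := InnerProductSpace.ofCore k.preCore

theorem inner_toPre (x y : X →₀ A) : ⟪k.toPre x, k.toPre y⟫_ℂ = k.form x y := rfl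

theorem norm_toPre_sq (x : X →₀ A) : ((‖k.toPre x‖ ^ 2 : ℝ) : ℂ) = k.form x x := by
  rw [← inner_toPre, inner_self_eq_norm_sq_to_K]; simp

/-- Left multiplication as a bounded operator. -/
noncomputable def lmulCLM [PartialOrder A] [StarOrderedRing A] (a : A) : k.Pre →L[ℂ] k.Pre :=
  (k.toPre.toLinearMap ∘ₗ lmul a ∘ₗ k.toPre.symm.toLinearMap).mkContinuous ‖a‖ fun x => by
    obtain ⟨x, rfl⟩ := k.toPre.surjective x
    have h := k.form_lmul_self_le a x
    rw [← norm_toPre_sq, ← norm_toPre_sq, ← Complex.ofReal_mul, Complex.real_le_real,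
      ← mul_pow, sq_le_sq₀ (by positivity) (by positivity)] at h
    simpa using h

theorem lmulCLM_apply [PartialOrder A] [StarOrderedRing A] (a : A) (x : X →₀ A) :
    k.lmulCLM a (k.toPre x) = k.toPre (lmul a x) := rfl

open UniformSpace Completion in
/-- The representation on the completion given by left multiplication. -/
noncomputable def toHilbertRep [PartialOrder A] [StarOrderedRing A] : HilbertRep A where
  space := UniformSpace.Completion k.Pre
  rep :=
    { toFun := fun a => (k.lmulCLM a).completion
      map_one' := by
        ext x
        induction x using induction_on with
        | hp => apply isClosed_eq <;> fun_prop
        | ih x =>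
          obtain ⟨x, rfl⟩ := k.toPre.surjective x
          simp [lmulCLM_apply, lmul_one]
      map_mul' := fun a b => by
        ext x
        induction x using induction_on with
        | hp => apply isClosed_eq <;> fun_prop
        | ih x =>
          obtain ⟨x, rfl⟩ := k.toPre.surjective x
          simp [lmulCLM_apply, lmul_mul]
      map_zero' := by
        ext x
        induction x using induction_on with
        | hp => apply isClosed_eq <;> fun_prop
        | ih x =>
          obtain ⟨x, rfl⟩ := k.toPre.surjective x
          have := lmul_smul 0 (0 : A) x
          rw [zero_smul, zero_smul] at this
          simp [lmulCLM_apply, this, Completion.coe_zero]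
      map_add' := fun a b => by
        ext x
        induction x using induction_on with
        | hp => apply isClosed_eq <;> fun_prop
        | ih x =>
          obtain ⟨x, rfl⟩ := k.toPre.surjective x
          simp [lmulCLM_apply, lmul_add, Completion.coe_add]
      commutes' := fun c => by
        ext x
        induction x using induction_on with
        | hp => apply isClosed_eq <;> fun_prop
        | ih x =>
          obtain ⟨x, rfl⟩ := k.toPre.surjective x
          simp [lmulCLM_apply, lmul_smul, lmul_one, Algebra.algebraMap_eq_smul_one]
      map_star' := fun a => by
        refine (ContinuousLinearMap.eq_adjoint_iff _ _).mpr fun x y => ?_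
        induction x, y using induction_on₂ with
        | hp => apply isClosed_eq <;> fun_prop
        | ih x y =>
          obtain ⟨x, rfl⟩ := k.toPre.surjective x
          obtain ⟨y, rfl⟩ := k.toPre.surjective y
          simp [lmulCLM_apply, inner_toPre, form_lmul] }

/-- The vector belonging to a point of `X`. -/
noncomputable def vec [PartialOrder A] [StarOrderedRing A] (s : X) : k.toHilbertRep.space :=
  ((k.toPre (Finsupp.single s 1) : k.Pre) : UniformSpace.Completion k.Pre)

theorem inner_vec [PartialOrder A] [StarOrderedRing A] (s t : X) (a : A) :
    ⟪k.vec s, k.toHilbertRep.rep a (k.vec t)⟫_ℂ = k.ker s t a := by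
  change ⟪((k.toPre _ : k.Pre) : UniformSpace.Completion k.Pre),
    (k.lmulCLM a).completion ((k.toPre _ : k.Pre) : UniformSpace.Completion k.Pre)⟫_ℂ = _
  simp [lmulCLM_apply, inner_toPre, lmul_single, form_single]

theorem exists_rep [PartialOrder A] [StarOrderedRing A] :
    ∃ (N : HilbertRep A) (w : X → N.space), ∀ s t a, ⟪w s, N.rep a (w t)⟫_ℂ = k.ker s t a :=
  ⟨k.toHilbertRep, k.vec, k.inner_vec⟩

end PositiveKernel

/-! ### Isometries and unitary transport. -/

theorem exists_linearIsometry_of_norm_eq {D V N : Type*} [AddCommGroup D] [Module ℂ D]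
    [NormedAddCommGroup V] [NormedSpace ℂ V] [NormedAddCommGroup N] [NormedSpace ℂ N]
    [CompleteSpace N] (X : D →ₗ[ℂ] V) (Y : D →ₗ[ℂ] N) (hX : DenseRange X)
    (h : ∀ d, ‖Y d‖ = ‖X d‖) : ∃ T : V →ₗᵢ[ℂ] N, ∀ d, T (X d) = Y d := by
  have hn : ∃ C, ∀ d, ‖Y d‖ ≤ C * ‖X d‖ := ⟨1, fun d => by rw [one_mul, h d]⟩
  have hT := fun d => LinearMap.extendOfNorm_eq hX hn d
  refine ⟨⟨(Y.extendOfNorm X).toLinearMap, fun v => ?_⟩, hT⟩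
  refine hX.induction_on (p := fun v => ‖Y.extendOfNorm X v‖ = ‖v‖) v
    (isClosed_eq (by fun_prop) (by fun_prop)) fun d => ?_
  rw [hT, h]

/-- Transport of a representation along a unitary. -/
noncomputable def StarAlgHom.conjUnitary {A K K' : Type*} [CStarAlgebra A] [NormedAddCommGroup K]
    [InnerProductSpace ℂ K] [CompleteSpace K] [NormedAddCommGroup K'] [InnerProductSpace ℂ K']
    [CompleteSpace K'] (U : K ≃ₗᵢ[ℂ] K') (π : A →⋆ₐ[ℂ] (K' →L[ℂ] K')) : A →⋆ₐ[ℂ] (K →L[ℂ] K) where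
  toFun a := U.symm.conjStarAlgEquiv (π a)
  map_one' := by rw [map_one, map_one]
  map_mul' _ _ := by rw [map_mul, map_mul]
  map_zero' := by rw [map_zero, map_zero]
  map_add' _ _ := by rw [map_add, map_add]
  commutes' c := by ext; simp [Algebra.algebraMap_eq_smul_one]
  map_star' _ := by rw [map_star, map_star]

theorem StarAlgHom.conjUnitary_apply {A K K' : Type*} [CStarAlgebra A] [NormedAddCommGroup K]
    [InnerProductSpace ℂ K] [CompleteSpace K] [NormedAddCommGroup K'] [InnerProductSpace ℂ K']
    [CompleteSpace K'] (U : K ≃ₗᵢ[ℂ] K') (π : A →⋆ₐ[ℂ] (K' →L[ℂ] K')) (a : A) (x : K) :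
    π.conjUnitary U a x = U.symm (π a (U x)) := rfl

/-! ### Dilating representations of `B` to representations of `A`. -/

section Dilation

variable {A B : Type u} [CStarAlgebra A] [CStarAlgebra B]

/-- A representation of `A` on an enlargement `V ⊕ V'` of the space of a representation `V` of `B`,
such that both summands are invariant under `B` and `B` acts on `V` as it did before. -/
structure RepDilation (ε : B →⋆ₐ[ℂ] A) (V : HilbertRep B) : Type (u + 1) where
  compl : HilbertRep B
  rep : A →⋆ₐ[ℂ] (WithLp 2 (V.space × compl.space) →L[ℂ] WithLp 2 (V.space × compl.space))
  rep_incl : ∀ b x, rep (ε b) x = WithLp.toLp 2 (V.rep b x.fst, compl.rep b x.snd)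

/-- The compression of the action of `A` to the space of the original representation. -/
noncomputable def RepDilation.corner {ε : B →⋆ₐ[ℂ] A} {V : HilbertRep B} (D : RepDilation ε V)
    (a : A) : V.space →L[ℂ] V.space :=
  (ContinuousLinearMap.fst ℂ V.space D.compl.space).comp <|
    (WithLp.prodContinuousLinearEquiv 2 ℂ V.space D.compl.space).toContinuousLinearMap.comp <|
    (D.rep a).comp <|
    (WithLp.prodContinuousLinearEquiv 2 ℂ V.space D.compl.space).symm.toContinuousLinearMap.comp <|
    ContinuousLinearMap.inl ℂ V.space D.compl.space

theorem RepDilation.corner_apply {ε : B →⋆ₐ[ℂ] A} {V : HilbertRep B} (D : RepDilation ε V)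
    (a : A) (x : V.space) : D.corner a x = (D.rep a (WithLp.toLp 2 (x, 0))).fst := rfl

/-- The orthogonal complement of the range of an intertwiner is invariant. -/
theorem HilbertRep.exists_orthogonalCompl {ε : B →⋆ₐ[ℂ] A} {V : HilbertRep B} {N : HilbertRep A}
    (T : V.space →ₗᵢ[ℂ] N.space) (hT : ∀ b x, T (V.rep b x) = N.rep (ε b) (T x)) :
    ∃ (L : HilbertRep B) (S : L.space →ₗᵢ[ℂ] N.space),
      LinearMap.range S.toLinearMap = (LinearMap.range T.toLinearMap)ᗮ ∧
      ∀ b x, S (L.rep b x) = N.rep (ε b) (S x) := by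
  have hinv : ∀ b, ∀ y ∈ (LinearMap.range T.toLinearMap)ᗮ,
      N.rep (ε b) y ∈ (LinearMap.range T.toLinearMap)ᗮ := fun b y hy => by
    rw [Submodule.mem_orthogonal] at hy ⊢
    rintro _ ⟨x, rfl⟩
    rw [LinearIsometry.coe_toLinearMap, N.inner_rep_right, ← map_star, ← hT]
    exact hy _ ⟨_, rfl⟩
  set M := (LinearMap.range T.toLinearMap)ᗮ
  let r : B → (M →L[ℂ] M) := fun b =>
    ((N.rep (ε b)).comp (Submodule.subtypeL _)).codRestrict _ fun y => hinv b y y.2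
  have hr : ∀ b y, (r b y : N.space) = N.rep (ε b) y := fun _ _ => rfl
  let π : B →⋆ₐ[ℂ] (M →L[ℂ] M) :=
    { toFun := r
      map_one' := by ext; simp [hr]
      map_mul' := fun _ _ => by ext; simp [hr]
      map_zero' := by ext; simp [hr]
      map_add' := fun _ _ => by ext; simp [hr]
      commutes' := fun c => by ext; simp [hr, Algebra.algebraMap_eq_smul_one]
      map_star' := fun b => by
        refine (ContinuousLinearMap.eq_adjoint_iff _ _).mpr fun x y => ?_
        rw [Submodule.coe_inner, Submodule.coe_inner, hr, hr, N.inner_rep_left, ← map_star,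
          star_star] }
  exact ⟨⟨M, π⟩, M.subtypeₗᵢ, by simp, fun b x => hr b x⟩

/-- The range of `T` is complete and invariant under `B`, so the space of `N` splits as that range
plus an orthogonal complement on which `B` also acts. Transporting `N` along the resulting unitary
gives the dilation. -/
theorem exists_dilation_of_intertwiner {ε : B →⋆ₐ[ℂ] A} {V : HilbertRep B} {N : HilbertRep A}
    (T : V.space →ₗᵢ[ℂ] N.space) (hT : ∀ b x, T (V.rep b x) = N.rep (ε b) (T x)) :
    ∃ D : RepDilation ε V, ∀ a x y,
      ⟪x, D.corner a y⟫_ℂ = ⟪T x, N.rep a (T y)⟫_ℂ := by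
  obtain ⟨L, S, hSrange, hS⟩ := HilbertRep.exists_orthogonalCompl T hT
  set R := LinearMap.range T.toLinearMap with hR
  have hRc : IsComplete (R : Set N.space) := by
    have := T.isometry.isUniformInducing.isComplete_range
    rwa [hR, LinearMap.coe_range]
  have : CompleteSpace R := hRc.completeSpace_coe
  let U₀ : WithLp 2 (V.space × L.space) →ₗ[ℂ] N.space :=
    (T.toLinearMap.coprod S.toLinearMap) ∘ₗ (WithLp.linearEquiv 2 ℂ _).toLinearMap
  have hU₀ : ∀ x, U₀ x = T x.fst + S x.snd := fun x => rfl
  have horth : ∀ x y, ⟪T x, S y⟫_ℂ = 0 := fun x y =>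
    Submodule.inner_right_of_mem_orthogonal (K := R) ⟨x, rfl⟩ (hSrange ▸ ⟨y, rfl⟩)
  have hnorm : ∀ x, ‖U₀ x‖ = ‖x‖ := fun x => by
    rw [← sq_eq_sq₀ (norm_nonneg _) (norm_nonneg _), hU₀, WithLp.prod_norm_sq_eq_of_L2, sq, sq, sq,
      norm_add_sq_eq_norm_sq_add_norm_sq_of_inner_eq_zero _ _ (horth _ _), T.norm_map, S.norm_map]
  have hsurj : Function.Surjective U₀ := fun n => by
    obtain ⟨x, hx⟩ : R.starProjection n ∈ R := R.starProjection_apply_mem n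
    obtain ⟨y, hy⟩ : n - R.starProjection n ∈ LinearMap.range S.toLinearMap :=
      hSrange ▸ R.sub_starProjection_mem_orthogonal n
    refine ⟨WithLp.toLp 2 (x, y), ?_⟩
    change T.toLinearMap x + S.toLinearMap y = n
    rw [hx, hy, add_sub_cancel]
  let U := LinearIsometryEquiv.ofSurjective (⟨U₀, hnorm⟩ : _ →ₗᵢ[ℂ] N.space) hsurj
  have hU : ∀ x, U x = T x.fst + S x.snd := fun x => rfl
  let π : A →⋆ₐ[ℂ] (WithLp 2 (V.space × L.space) →L[ℂ] WithLp 2 (V.space × L.space)) :=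
    N.rep.conjUnitary U
  have hπ : ∀ a x, π a x = U.symm (N.rep a (U x)) := fun a x => rfl
  refine ⟨⟨L, π, fun b x => ?_⟩, fun a x y => ?_⟩
  · rw [hπ, LinearIsometryEquiv.symm_apply_eq, hU, hU, map_add, ← hT, ← hS]
    rfl
  · have h : ⟪WithLp.toLp 2 (x, (0 : L.space)), π a (WithLp.toLp 2 (y, 0))⟫_ℂ =
        ⟪x, (π a (WithLp.toLp 2 (y, 0))).fst⟫_ℂ := by
      simp [WithLp.prod_inner_apply]
    rw [RepDilation.corner_apply]
    have hx : ∀ z, U (WithLp.toLp 2 (z, 0)) = T z := fun z => by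
      rw [hU]; exact (congrArg _ (map_zero S)).trans (add_zero _)
    rw [← h, hπ, ← U.inner_map_map, U.apply_symm_apply, hx, hx]

/-- The map `b ↦ b v`. -/
noncomputable def HilbertRep.orbit (V : HilbertRep B) (v : V.space) : B →ₗ[ℂ] V.space where
  toFun b := V.rep b v
  map_add' _ _ := by simp
  map_smul' _ _ := by simp

/-- The map `(b s) ↦ ∑ s, b s (v s)`. -/
noncomputable def HilbertRep.orbitSum (V : HilbertRep B) {X : Type u} (v : X → V.space) :
    (X →₀ B) →ₗ[ℂ] V.space :=
  Finsupp.lsum ℂ fun s => V.orbit (v s)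

theorem HilbertRep.orbitSum_apply (V : HilbertRep B) {X : Type u} (v : X → V.space)
    (x : X →₀ B) : V.orbitSum v x = x.sum fun s b => V.rep b (v s) := rfl

theorem HilbertRep.orbitSum_single (V : HilbertRep B) {X : Type u} (v : X → V.space)
    (s : X) (b : B) : V.orbitSum v (Finsupp.single s b) = V.rep b (v s) := by
  rw [orbitSum_apply, Finsupp.sum_single_index (by simp)]

theorem HilbertRep.inner_orbitSum (V : HilbertRep B) {X : Type u} (v : X → V.space)
    (x y : X →₀ B) : ⟪V.orbitSum v x, V.orbitSum v y⟫_ℂ =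
      x.sum fun s b => y.sum fun t c => ⟪v s, V.rep (star b * c) (v t)⟫_ℂ := by
  rw [orbitSum_apply, orbitSum_apply, Finsupp.sum_inner]
  simp only [Finsupp.inner_sum]
  simp [V.inner_rep_left, Finsupp.sum]

/-- A positive kernel on a generating set of vectors of a representation of `B`, with values in the
functionals on `A` and extending the coefficients of the representation, gives a dilation. -/
theorem PositiveKernel.exists_dilation [PartialOrder A] [StarOrderedRing A] {ε : B →⋆ₐ[ℂ] A}
    {V : HilbertRep B} {X : Type u} (k : PositiveKernel X A) (v : X → V.space)
    (hv : DenseRange (V.orbitSum v))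
    (hk : ∀ s t b, k.ker s t (ε b) = ⟪v s, V.rep b (v t)⟫_ℂ) :
    ∃ D : RepDilation ε V, ∀ a s t b c,
      ⟪V.rep b (v s), D.corner a (V.rep c (v t))⟫_ℂ =
        k.ker s t (ε (star b) * a * ε c) := by
  obtain ⟨N, w, hw⟩ := k.exists_rep
  let NB : HilbertRep B := ⟨N.space, N.rep.comp ε⟩
  have hNB : ∀ b x, NB.rep b x = N.rep (ε b) x := fun _ _ => rfl
  -- By `hk`, the orbits of `w` under `B` have the same Gram matrix as those of `v`. Hence `b (v s)
  -- ↦ ε b (w s)` extends to an isometry.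
  have hnorm : ∀ x, ‖NB.orbitSum w x‖ = ‖V.orbitSum v x‖ := fun x => by
    have h : ⟪NB.orbitSum w x, NB.orbitSum w x⟫_ℂ =
        ⟪V.orbitSum v x, V.orbitSum v x⟫_ℂ := by
      rw [HilbertRep.inner_orbitSum, HilbertRep.inner_orbitSum]
      refine Finsupp.sum_congr fun s _ => Finsupp.sum_congr fun t _ => ?_
      rw [hNB, ← hk]
      exact hw s t _
    rw [inner_self_eq_norm_sq_to_K, inner_self_eq_norm_sq_to_K] at h
    exact (sq_eq_sq₀ (norm_nonneg _) (norm_nonneg _)).mp (by exact_mod_cast h)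
  obtain ⟨T, hT⟩ := exists_linearIsometry_of_norm_eq (V.orbitSum v) (NB.orbitSum w) hv hnorm
  have hTs : ∀ b s, T (V.rep b (v s)) = N.rep (ε b) (w s) := fun b s => by
    rw [← V.orbitSum_single, hT, NB.orbitSum_single, hNB]
  have hTrep : ∀ b x, T (V.rep b x) = N.rep (ε b) (T x) := fun b x => by
    refine hv.induction_on (p := fun x => T (V.rep b x) = N.rep (ε b) (T x)) x
      (isClosed_eq (by fun_prop) (by fun_prop)) fun x => ?_
    induction x using Finsupp.induction_linear with
    | zero => simp
    | add x y hx hy => simp only [map_add, hx, hy]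
    | single s c =>
      rw [V.orbitSum_single, hTs, ← mul_apply_eq_comp, ← map_mul, hTs, map_mul, map_mul]
      rfl
  obtain ⟨D, hD⟩ := exists_dilation_of_intertwiner (N := N) T hTrep
  refine ⟨D, fun a s t b c => ?_⟩
  rw [hD, hTs, hTs, N.inner_rep_left, ← map_star, ← mul_apply_eq_comp,
    ← mul_apply_eq_comp, ← map_mul, ← map_mul, hw]

end Dilation

/-! ### Positive elements and extension of positive functionals. -/

section Positivity

theorem exists_eq_star_mul_self {A : Type*} [NonUnitalCStarAlgebra A] [PartialOrder A]
    [StarOrderedRing A] {a : A} (ha : 0 ≤ a) : ∃ b, a = star b * b :=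
  CStarAlgebra.nonneg_iff_eq_star_mul_self.mp ha

/-- The negative part `n` of `a` satisfies `n * a * n = -n ^ 3`. -/
theorem exists_conjugate_nonpos {A : Type*} [NonUnitalCStarAlgebra A] [PartialOrder A]
    [StarOrderedRing A] {a : A} (ha : IsSelfAdjoint a) :
    ∃ n : A, IsSelfAdjoint n ∧ n * a * n ≤ 0 ∧ (n * a * n = 0 → 0 ≤ a) := by
  have hn := CFC.negPart_nonneg a
  have hs : IsSelfAdjoint a⁻ := IsSelfAdjoint.of_nonneg hn
  have key : a⁻ * a * a⁻ = -(a⁻ * a⁻ * a⁻) := by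
    nth_rw 2 [← CFC.posPart_sub_negPart a ha]
    rw [mul_sub, CFC.negPart_mul_posPart, zero_sub, neg_mul]
  refine ⟨a⁻, hs, ?_, fun h => ?_⟩
  · rw [key, neg_nonpos]
    exact hs.conjugate_nonneg hn
  · rw [key, neg_eq_zero] at h
    have h2 : a⁻ * a⁻ = 0 := by
      rw [← CStarRing.star_mul_self_eq_zero_iff, star_mul, hs.star_eq, ← mul_assoc, h, zero_mul]
    have h1 : a⁻ = 0 := by
      rw [← CStarRing.star_mul_self_eq_zero_iff, hs.star_eq, h2]
    exact (CFC.negPart_eq_zero_iff a ha).mp h1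

variable {A B : Type*} [CStarAlgebra A] [PartialOrder A] [StarOrderedRing A]
  [CStarAlgebra B] [PartialOrder B] [StarOrderedRing B]

/-- With `n` the negative part of `b`, the image of `n * b * n` is both nonpositive and nonnegative,
hence zero. Injectivity then gives `n * b * n = 0`. -/
theorem StarAlgHom.nonneg_of_injective (ε : B →⋆ₐ[ℂ] A) (hε : Function.Injective ε) {b : B}
    (h : 0 ≤ ε b) : 0 ≤ b := by
  have hb : IsSelfAdjoint b := hε (by rw [map_star, (IsSelfAdjoint.of_nonneg h).star_eq])
  obtain ⟨n, hn, hle, himp⟩ := exists_conjugate_nonpos hb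
  refine himp (hε ?_)
  refine le_antisymm ?_ ?_
  · exact OrderHomClass.mono ε hle
  · rw [map_zero, map_mul, map_mul]
    exact (hn.map ε).conjugate_nonneg h

/-- A positive functional extends from a C⋆-subalgebra. -/
theorem exists_positive_extension (ε : B →⋆ₐ[ℂ] A) (hε : Function.Injective ε) (φ : B →ₗ[ℂ] ℂ)
    (hφ : ∀ b, 0 ≤ b → 0 ≤ φ b) :
    ∃ f : A →ₗ[ℂ] ℂ, (∀ a, 0 ≤ a → 0 ≤ f a) ∧ ∀ b, f (ε b) = φ b := by
  -- The cone of elements with positive real part contains every skew-adjoint element. A real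
  -- functional nonnegative on it therefore vanishes on skew-adjoint elements, so its
  -- complexification is real on self-adjoint ones.
  let s : PointedCone ℝ A :=
    { carrier := {a | 0 ≤ a + star a}
      zero_mem' := by simp
      add_mem' := fun {a b} ha hb => by
        simp only [Set.mem_ofPred_eq] at *
        rw [star_add, add_add_add_comm]; exact add_nonneg ha hb
      smul_mem' := fun c a ha => by
        simp only [Set.mem_ofPred_eq] at *
        obtain ⟨c, hc⟩ := c
        change 0 ≤ c • a + star (c • a)
        rw [star_smul, star_trivial, ← smul_add]
        exact smul_nonneg hc ha }
  have hs : ∀ a, a ∈ s ↔ 0 ≤ a + star a := fun a => Iff.rfl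
  let ε' : B →ₗ[ℝ] A := ε.toAlgHom.toLinearMap.restrictScalars ℝ
  let e := LinearEquiv.ofInjective ε' hε
  have he : ∀ b, ((e b : LinearMap.range ε') : A) = ε b := fun _ => rfl
  let p : A →ₗ.[ℝ] ℝ := ⟨LinearMap.range ε',
    (Complex.reLm ∘ₗ φ.restrictScalars ℝ) ∘ₗ e.symm.toLinearMap⟩
  have hp : ∀ b, p (e b) = (φ b).re := fun b => by
    change (φ (e.symm (e b))).re = _
    rw [e.symm_apply_apply]
  have hstar : ∀ b, φ (star b) = star (φ b) := fun b =>
    map_star (PositiveLinearMap.mk₀ φ hφ) b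
  obtain ⟨g, hg, hgs⟩ := riesz_extension s p (fun x hx => by
      obtain ⟨b, rfl⟩ := e.surjective x
      rw [hs, he, ← map_star, ← map_add] at hx
      have h := hφ _ (ε.nonneg_of_injective hε hx)
      rw [map_add, hstar] at h
      have h2 := (Complex.le_def.mp h).1
      simp at h2
      rw [hp]; linarith) (fun y => by
      -- The domain is cofinal for the cone: a scalar dominating `-(y + star y)` lies in the image
      -- of `B`.
      refine ⟨e (algebraMap ℝ B ‖y + star y‖), ?_⟩
      rw [hs, he]
      have h1 : ε (algebraMap ℝ B ‖y + star y‖) = algebraMap ℝ A ‖y + star y‖ := by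
        rw [Algebra.algebraMap_eq_smul_one, Algebra.algebraMap_eq_smul_one, ← Complex.coe_smul,
          map_smul, map_one, Complex.coe_smul]
      have h2 : -(y + star y) ≤ algebraMap ℝ A ‖y + star y‖ := by
        have := IsSelfAdjoint.le_algebraMap_norm_self (a := -(y + star y))
          (by simp [IsSelfAdjoint, add_comm])
        rwa [norm_neg] at this
      have h3 : (0 : A) ≤ algebraMap ℝ A ‖y + star y‖ := algebraMap_nonneg A (norm_nonneg _)
      have h4 : star (algebraMap ℝ A ‖y + star y‖) = algebraMap ℝ A ‖y + star y‖ :=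
        (IsSelfAdjoint.of_nonneg h3).star_eq
      rw [h1, star_add, h4, add_add_add_comm]
      rw [add_assoc, add_comm _ (y + star y)]
      exact add_nonneg h3 (neg_le_iff_add_nonneg'.mp h2))
  have hgε : ∀ b, g (ε b) = (φ b).re := fun b => by rw [← hp, ← hg, he]
  -- The complexification is `a ↦ g a - i g (i a)`.
  refine ⟨Module.Dual.extendRCLike g, fun a ha => ?_, fun b => ?_⟩
  · have hsa : star a = a := (IsSelfAdjoint.of_nonneg ha).star_eq
    have hskew : star (Complex.I • a) = -(Complex.I • a) := by simp [hsa]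
    have h1 := hgs a (by rw [hs, hsa]; exact add_nonneg ha ha)
    have h2 := hgs (Complex.I • a) (by rw [hs, hskew, add_neg_cancel])
    have h3 := hgs (-(Complex.I • a)) (by rw [hs, star_neg, hskew, neg_neg, neg_add_cancel])
    rw [map_neg] at h3
    have h4 : g (Complex.I • a) = 0 := le_antisymm (by linarith) h2
    rw [Module.Dual.extendRCLike_apply]
    simp only [RCLike.I_to_complex, h4]
    simpa using h1
  · rw [Module.Dual.extendRCLike_apply]
    simp only [RCLike.I_to_complex]
    rw [← map_smul, hgε, hgε]
    apply Complex.ext <;> simp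

end Positivity

/-! ### Positivity of operator matrices and complete positivity. -/

section CStarMatrix

variable {H : Type*} [NormedAddCommGroup H] [InnerProductSpace ℂ H] {n : Type*} [Fintype n]

namespace CStarMatrix

/-- The sesquilinear form of a matrix of operators. -/
noncomputable def form (M : CStarMatrix n n (H →L[ℂ] H)) (h k : n → H) : ℂ :=
  ∑ s, ∑ t, ⟪h s, M s t (k t)⟫_ℂ

/-- The action of a matrix of operators on a vector of vectors. -/
noncomputable def act (M : CStarMatrix n n (H →L[ℂ] H)) (h : n → H) : n → H :=
  fun s => ∑ t, M s t (h t)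

theorem form_eq (M : CStarMatrix n n (H →L[ℂ] H)) (h k : n → H) :
    M.form h k = ∑ s, ⟪h s, M.act k s⟫_ℂ := by
  simp [form, act]

theorem form_neg (M : CStarMatrix n n (H →L[ℂ] H)) (h k : n → H) :
    (-M).form h k = -M.form h k := by
  simp [form]

theorem act_mul (M N : CStarMatrix n n (H →L[ℂ] H)) (h : n → H) :
    (M * N).act h = M.act (N.act h) := by
  funext s
  simp only [act, mul_apply, _root_.sum_apply, map_sum, mul_apply_eq_comp]
  exact Finset.sum_comm

theorem form_mul (M N : CStarMatrix n n (H →L[ℂ] H)) (h k : n → H) :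
    (M * N).form h k = M.form h (N.act k) := by
  rw [form_eq, form_eq, act_mul]

variable [CompleteSpace H]

theorem inner_act_left (M : CStarMatrix n n (H →L[ℂ] H)) (h k : n → H) :
    ∑ s, ⟪M.act h s, k s⟫_ℂ = (star M).form h k := by
  simp only [form, act, sum_inner, star_apply, ContinuousLinearMap.star_eq_adjoint,
    ContinuousLinearMap.adjoint_inner_right]
  exact Finset.sum_comm

theorem form_act_left (M N : CStarMatrix n n (H →L[ℂ] H)) (h k : n → H) :
    M.form (N.act h) k = (star N * M).form h k := by
  rw [form_mul, ← inner_act_left, form_eq]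

theorem form_star_mul_self (N : CStarMatrix n n (H →L[ℂ] H)) (h : n → H) :
    (star N * N).form h h = ((∑ s, ‖N.act h s‖ ^ 2 : ℝ) : ℂ) := by
  rw [← form_act_left, form_eq, Complex.ofReal_sum]
  refine Finset.sum_congr rfl fun s _ => ?_
  rw [inner_self_eq_norm_sq_to_K]
  simp

theorem form_nonneg {M : CStarMatrix n n (H →L[ℂ] H)} (hM : 0 ≤ M) (h : n → H) :
    0 ≤ M.form h h := by
  obtain ⟨N, rfl⟩ := exists_eq_star_mul_self hM
  rw [form_star_mul_self]
  exact Complex.zero_le_real.mpr (Finset.sum_nonneg fun s _ => sq_nonneg _)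

theorem eq_zero_of_form_eq_zero {M : CStarMatrix n n (H →L[ℂ] H)} (hM : 0 ≤ M)
    (h : ∀ k, M.form k k = 0) : M = 0 := by
  classical
  obtain ⟨N, rfl⟩ := exists_eq_star_mul_self hM
  have hact : ∀ k s, N.act k s = 0 := fun k s => by
    have h1 := h k
    rw [form_star_mul_self, Complex.ofReal_eq_zero,
      Finset.sum_eq_zero_iff_of_nonneg fun s _ => sq_nonneg _] at h1
    simpa using h1 s (Finset.mem_univ s)
  have hN : N = 0 := by
    refine CStarMatrix.ext fun s t => ContinuousLinearMap.ext fun x => ?_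
    have := hact (Pi.single t x) s
    rw [act, Finset.sum_eq_single t (fun r _ hr => by simp [hr]) (by simp)] at this
    simpa using this
  rw [hN, mul_zero]

/-- Conjugating `M` by its negative part gives a nonpositive matrix whose form is a value of the
form of `M`, hence nonnegative. The form thus vanishes, and so does the conjugated matrix. -/
theorem nonneg_of_form_nonneg {M : CStarMatrix n n (H →L[ℂ] H)}
    (hM : IsSelfAdjoint M) (h : ∀ k, 0 ≤ M.form k k) : 0 ≤ M := by
  obtain ⟨N, hN, hle, himp⟩ := exists_conjugate_nonpos hM
  refine himp (neg_eq_zero.mp ?_)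
  refine eq_zero_of_form_eq_zero (neg_nonneg.mpr hle) fun k => ?_
  have h1 := form_nonneg (neg_nonneg.mpr hle) k
  have h2 : (N * M * N).form k k = M.form (N.act k) (N.act k) := by
    rw [form_act_left, hN.star_eq, form_mul]
  rw [form_neg, h2] at h1 ⊢
  exact le_antisymm (neg_nonpos.mpr (h _)) h1

end CStarMatrix

end CStarMatrix

/-- The compression of a ⋆-representation to the range of an isometry is completely positive. -/
noncomputable def CompletelyPositiveMap.compression {D H K : Type*} [CStarAlgebra D]
    [PartialOrder D] [StarOrderedRing D] [NormedAddCommGroup H] [InnerProductSpace ℂ H]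
    [CompleteSpace H] [NormedAddCommGroup K] [InnerProductSpace ℂ K] [CompleteSpace K]
    (π : D →⋆ₐ[ℂ] (K →L[ℂ] K)) (S : H →L[ℂ] K) : D →CP (H →L[ℂ] H) where
  toFun x := (ContinuousLinearMap.adjoint S).comp ((π x).comp S)
  map_add' x y := by simp
  map_smul' c x := by simp
  map_cstarMatrix_nonneg' k M hM := by
    have hπ : 0 ≤ M.map π := NonUnitalStarAlgHomClass.instCompletelyPositiveMapClass
      |>.map_cstarMatrix_nonneg' π k M hM
    have hsa : star M = M := (IsSelfAdjoint.of_nonneg hM).star_eq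
    refine CStarMatrix.nonneg_of_form_nonneg (CStarMatrix.ext fun s t => ?_) fun h => ?_
    · rw [CStarMatrix.star_apply, CStarMatrix.map_apply, CStarMatrix.map_apply]
      conv_rhs => rw [← hsa, CStarMatrix.star_apply]
      simp [ContinuousLinearMap.star_eq_adjoint, ContinuousLinearMap.adjoint_comp, map_star,
        ContinuousLinearMap.comp_assoc]
    · have := CStarMatrix.form_nonneg hπ fun s => S (h s)
      simpa [CStarMatrix.form, ContinuousLinearMap.adjoint_inner_right] using this

theorem CompletelyPositiveMap.inner_compression {D H K : Type*} [CStarAlgebra D]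
    [PartialOrder D] [StarOrderedRing D] [NormedAddCommGroup H] [InnerProductSpace ℂ H]
    [CompleteSpace H] [NormedAddCommGroup K] [InnerProductSpace ℂ K] [CompleteSpace K]
    (π : D →⋆ₐ[ℂ] (K →L[ℂ] K)) (S : H →L[ℂ] K) (x : D) (h k : H) :
    ⟪h, compression π S x k⟫_ℂ = ⟪S h, π x (S k)⟫_ℂ := by
  have h1 : compression π S x k = ContinuousLinearMap.adjoint S (π x (S k)) := rfl
  rw [h1, ContinuousLinearMap.adjoint_inner_right]

theorem CompletelyPositiveMap.sum_inner_nonneg {A H : Type*} [CStarAlgebra A] [PartialOrder A]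
    [StarOrderedRing A] [NormedAddCommGroup H] [InnerProductSpace ℂ H] [CompleteSpace H]
    (Φ : A →CP (H →L[ℂ] H)) (s : Finset H) (x : H → A) :
    0 ≤ ∑ h ∈ s, ∑ k ∈ s, ⟪h, Φ (star (x h) * x k) k⟫_ℂ := by
  rcases s.eq_empty_or_nonempty with rfl | hs
  · simp
  -- All rows equal `x`, so `star N * N` has the wanted entries times the factor `s.card`, which is
  -- divided out at the end.
  let N : CStarMatrix s s A := fun _ k => x k
  have hN : ∀ h k, (star N * N) h k = s.card • (star (x h) * x k) := fun h k => by
    rw [CStarMatrix.mul_apply]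
    simp only [CStarMatrix.star_apply]
    simp [N]
  have h1 := CStarMatrix.form_nonneg
    (Φ.map_cstarMatrix_nonneg _ (star_mul_self_nonneg N)) (fun h : s => (h : H))
  have h2 : ((star N * N).map Φ).form (fun h : s => (h : H)) (fun h : s => (h : H)) =
      (s.card : ℂ) * ∑ h ∈ s, ∑ k ∈ s, ⟪h, Φ (star (x h) * x k) k⟫_ℂ := by
    simp only [CStarMatrix.form, CStarMatrix.map_apply, hN, map_nsmul]
    rw [← Finset.sum_coe_sort s, Finset.mul_sum]
    refine Finset.sum_congr rfl fun h _ => ?_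
    rw [← Finset.sum_coe_sort s, Finset.mul_sum]
    refine Finset.sum_congr rfl fun k _ => ?_
    rw [← Nat.cast_smul_eq_nsmul ℂ]
    simp
  rw [h2] at h1
  have h3 := mul_nonneg (inv_nonneg.mpr (Nat.cast_nonneg (α := ℂ) s.card)) h1
  rwa [inv_mul_cancel_left₀ (Nat.cast_ne_zero.mpr hs.card_pos.ne')] at h3

/-! ### Dilations from completely positive maps, functionals and conditional expectations. -/

section Existence

variable {A B : Type u} [CStarAlgebra A] [PartialOrder A] [StarOrderedRing A]
  [CStarAlgebra B]

/-- Stinespring's theorem, for a completely positive map that is multiplicative on `B`. -/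
theorem CompletelyPositiveMap.exists_dilation {ε : B →⋆ₐ[ℂ] A} {V : HilbertRep B}
    (Φ : A →CP (V.space →L[ℂ] V.space)) (hΦ : ∀ b, Φ (ε b) = V.rep b) :
    ∃ D : RepDilation ε V, ∀ a x, D.corner a x = Φ a x := by
  let k : PositiveKernel V.space A :=
    { ker := fun h k =>
        { toFun := fun a => ⟪h, Φ a k⟫_ℂ
          map_add' := by simp
          map_smul' := by simp }
      ker_star := fun s t a => by
        change ⟪s, Φ (star a) t⟫_ℂ = star ⟪t, Φ a s⟫_ℂ
        rw [map_star, ContinuousLinearMap.star_eq_adjoint, ContinuousLinearMap.adjoint_inner_right]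
        exact (inner_conj_symm _ _).symm
      nonneg := fun x => Φ.sum_inner_nonneg x.support x }
  -- Every vector serves as a generator.
  obtain ⟨D, hD⟩ := k.exists_dilation (ε := ε) (V := V) id
    (Function.Surjective.denseRange fun x => ⟨Finsupp.single x 1, by
      rw [V.orbitSum_single, map_one]; rfl⟩)
    fun s t b => by
      change ⟪s, Φ (ε b) t⟫_ℂ = _
      rw [hΦ]; rfl
  refine ⟨D, fun a x => ext_inner_left ℂ fun y => ?_⟩
  have := hD a y x 1 1
  rw [map_one] at this
  refine this.trans ?_
  change ⟪y, Φ _ x⟫_ℂ = _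
  simp

/-- Every representation is generated by vectors with mutually orthogonal orbits. -/
theorem HilbertRep.exists_orthogonal_generators (V : HilbertRep B) :
    ∃ S : Set V.space, (∀ s ∈ S, ∀ t ∈ S, s ≠ t → ∀ b, ⟪s, V.rep b t⟫_ℂ = 0) ∧
      DenseRange (V.orbitSum ((↑) : S → V.space)) := by
  obtain ⟨S, hS⟩ := zorn_subset
    {S : Set V.space | ∀ s ∈ S, ∀ t ∈ S, s ≠ t → ∀ b, ⟪s, V.rep b t⟫_ℂ = 0} (fun c hc hch => by
      refine ⟨⋃₀ c, ?_, fun s hs => Set.subset_sUnion_of_mem hs⟩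
      rintro s ⟨S, hS, hsS⟩ t ⟨T, hT, htT⟩ hst b
      rcases hch.total hS hT with h | h
      · exact hc hT s (h hsS) t htT hst b
      · exact hc hS s hsS t (h htT) hst b)
  refine ⟨S, hS.prop, ?_⟩
  set R := LinearMap.range (V.orbitSum ((↑) : S → V.space)) with hR
  change Dense (Set.range _)
  rw [← LinearMap.coe_range, ← hR, Submodule.dense_iff_topologicalClosure_eq_top,
    Submodule.topologicalClosure_eq_top_iff, Submodule.eq_bot_iff]
  intro v hv
  have horth : ∀ b, ∀ s ∈ S, ⟪v, V.rep b s⟫_ℂ = 0 := fun b s hs =>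
    Submodule.inner_left_of_mem_orthogonal (K := R)
      ⟨Finsupp.single ⟨s, hs⟩ b, V.orbitSum_single _ _ _⟩ hv
  -- A vector orthogonal to all orbits can be added to `S`. Maximality puts it in `S`, so it is
  -- orthogonal to itself.
  have hvS : v ∈ S := by
    refine hS.le_of_ge (y := insert v S) ?_ (Set.subset_insert v S) (Set.mem_insert v S)
    rintro s (rfl | hs) t (rfl | ht) hst b
    · exact absurd rfl hst
    · exact horth b t ht
    · rw [V.inner_rep_right, ← inner_conj_symm, horth _ s hs, map_zero]
    · exact hS.prop s hs t ht hst b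
  have := horth 1 v hvS
  rwa [map_one, one_apply_eq_self, inner_self_eq_zero] at this

/-- Positive functionals on `A` which extend the vector states of a representation of `B` give a
dilation. -/
theorem HilbertRep.exists_dilation_of_functionals (ε : B →⋆ₐ[ℂ] A) (V : HilbertRep B)
    (f : V.space → A →ₗ[ℂ] ℂ) (hf : ∀ v a, 0 ≤ a → 0 ≤ f v a)
    (hfε : ∀ v b, f v (ε b) = ⟪v, V.rep b v⟫_ℂ) :
    ∃ (D : RepDilation ε V) (S : Set V.space), DenseRange (V.orbitSum ((↑) : S → V.space)) ∧
      ∀ a, ∀ s ∈ S, ∀ t ∈ S, ∀ b c,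
        (s = t → f s (ε (star b) * a * ε c) = 0) →
        ⟪V.rep b s, D.corner a (V.rep c t)⟫_ℂ = 0 := by
  classical
  obtain ⟨S, hS, hd⟩ := V.exists_orthogonal_generators
  have hstar : ∀ v a, f v (star a) = star (f v a) := fun v a =>
    map_star (PositiveLinearMap.mk₀ (f v) (hf v)) a
  let k : PositiveKernel S A :=
    { ker := fun s t => if s = t then f s else 0
      ker_star := fun s t a => by
        by_cases h : s = t
        · subst h; simpa using hstar _ _
        · simp [h, Ne.symm h]
      nonneg := fun x => by
        -- The kernel is diagonal, so the double sum reduces to the terms `f s (star (x s) * x s)`.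
        -- Positivity of each functional suffices; no complete positivity enters.
        refine Finset.sum_nonneg fun s hs => ?_
        have h := Finset.sum_eq_single_of_mem (f := fun t => (if s = t then f s else 0)
          (star (x s) * x t)) s hs fun t _ hst => by simp [Ne.symm hst]
        refine le_of_le_of_eq ?_ h.symm
        simpa using hf _ _ (star_mul_self_nonneg _) }
  obtain ⟨D, hD⟩ := k.exists_dilation (ε := ε) ((↑) : S → V.space) hd fun s t b => by
    change (if s = t then f s else 0) _ = _
    by_cases h : s = t
    · subst h; simpa using hfε _ _
    · rw [if_neg h, hS s s.2 t t.2 (fun h' => h (Subtype.ext h'))]; rfl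
  refine ⟨D, S, hd, fun a s hs t ht b c h => ?_⟩
  rw [hD a ⟨s, hs⟩ ⟨t, ht⟩ b c]
  change (if (⟨s, hs⟩ : S) = ⟨t, ht⟩ then f s else 0) _ = _
  split_ifs with hst
  · exact h (congrArg Subtype.val hst)
  · rfl

variable [PartialOrder B] [StarOrderedRing B]

theorem HilbertRep.inner_rep_self_nonneg (V : HilbertRep B) (v : V.space) {b : B} (hb : 0 ≤ b) :
    0 ≤ ⟪v, V.rep b v⟫_ℂ := by
  obtain ⟨c, rfl⟩ := exists_eq_star_mul_self hb
  rw [map_mul, mul_apply_eq_comp, V.inner_rep_right, star_star, inner_self_eq_norm_sq_to_K]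
  simp

/-- The functional `b ↦ ⟪v, b v⟫`. -/
noncomputable def HilbertRep.vectorFunctional (V : HilbertRep B) (v : V.space) : B →ₗ[ℂ] ℂ where
  toFun b := ⟪v, V.rep b v⟫_ℂ
  map_add' := by simp
  map_smul' := by simp

theorem HilbertRep.nonempty_dilation {ε : B →⋆ₐ[ℂ] A} (hε : Function.Injective ε)
    (V : HilbertRep B) : Nonempty (RepDilation ε V) := by
  choose f hf hfε using fun v => exists_positive_extension ε hε (V.vectorFunctional v)
    fun b hb => V.inner_rep_self_nonneg v hb
  obtain ⟨D, -⟩ := V.exists_dilation_of_functionals ε f hf hfε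
  exact ⟨D⟩

/-- The vector states of `V` are extended by composing with `E`. The bimodule property makes the
kernel of `E` stable under multiplication by `B` on both sides, so all matrix coefficients of the
corner vanish on a dense set. -/
theorem ConditionalExpectation.exists_dilation {ε : B →⋆ₐ[ℂ] A} (E : ConditionalExpectation ε)
    (V : HilbertRep B) :
    ∃ D : RepDilation ε V, ∀ a, E.toLinearMap a = 0 →
      ∀ x, D.corner a x = 0 := by
  obtain ⟨D, S, hd, hD⟩ := V.exists_dilation_of_functionals ε
    (fun v => V.vectorFunctional v ∘ₗ E.toLinearMap)
    (fun v a ha => V.inner_rep_self_nonneg v (E.nonneg' a ha))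
    (fun v b => congrArg (V.vectorFunctional v) (E.map_incl' b))
  refine ⟨D, fun a ha => ?_⟩
  have hE : ∀ b c, E.toLinearMap (ε b * a * ε c) = 0 := fun b c => by
    have h1 : E.toLinearMap (ε b * a * ε c) = E.toLinearMap (ε b * a) * c := E.map_mul_incl' _ _
    have h2 : E.toLinearMap (ε b * a) = b * E.toLinearMap a := E.map_incl_mul' _ _
    rw [h1, h2, ha, mul_zero, zero_mul]
  have key : ∀ x y, ⟪V.orbitSum ((↑) : S → V.space) x,
      D.corner a (V.orbitSum ((↑) : S → V.space) y)⟫_ℂ = 0 := fun x y => by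
    induction x using Finsupp.induction_linear with
    | zero => simp
    | add x x' hx hx' => rw [map_add, inner_add_left, hx, hx', add_zero]
    | single s b =>
      induction y using Finsupp.induction_linear with
      | zero => simp
      | add y y' hy hy' => rw [map_add, map_add, inner_add_right, hy, hy', add_zero]
      | single t c =>
        rw [V.orbitSum_single, V.orbitSum_single]
        refine hD a s s.2 t t.2 b c fun _ => ?_
        rw [LinearMap.comp_apply, hE, map_zero]
  intro x
  refine hd.induction_on (p := fun x => D.corner a x = 0) x
    (isClosed_eq (by fun_prop) (by fun_prop)) fun y => ?_
  refine ext_inner_left ℂ fun z => ?_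
  rw [inner_zero_right]
  exact hd.induction_on (p := fun z => ⟪z, D.corner a (V.orbitSum _ y)⟫_ℂ = 0) z
    (isClosed_eq (by fun_prop) (by fun_prop)) fun x => key x y

end Existence

/-! ### Hilbert sums of representations, grouped in pairs. -/

section HilbertSum

/-- The direct sum of a family of ⋆-representations. -/
noncomputable def lp.diagRep {A : Type*} [CStarAlgebra A] {Y : Type*} {G : Y → Type*}
    [∀ y, NormedAddCommGroup (G y)] [∀ y, InnerProductSpace ℂ (G y)] [∀ y, CompleteSpace (G y)]
    (π : ∀ y, A →⋆ₐ[ℂ] (G y →L[ℂ] G y)) : A →⋆ₐ[ℂ] (lp G 2 →L[ℂ] lp G 2) where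
  toFun a := lp.mapCLM 2 (fun y => π y a) (norm_nonneg a)
    fun y => NonUnitalStarAlgHom.norm_apply_le (π y) a
  map_one' := by ext; simp
  map_mul' a b := by ext; simp
  map_zero' := by ext; simp
  map_add' a b := by ext; simp
  commutes' c := by ext; simp [Algebra.algebraMap_eq_smul_one]
  map_star' a := by
    refine (ContinuousLinearMap.eq_adjoint_iff _ _).mpr fun x y => ?_
    rw [lp.inner_eq_tsum, lp.inner_eq_tsum]
    refine tsum_congr fun i => ?_
    simp [map_star, ContinuousLinearMap.star_eq_adjoint, ContinuousLinearMap.adjoint_inner_left]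

theorem lp.diagRep_apply {A : Type*} [CStarAlgebra A] {Y : Type*} {G : Y → Type*}
    [∀ y, NormedAddCommGroup (G y)] [∀ y, InnerProductSpace ℂ (G y)] [∀ y, CompleteSpace (G y)]
    (π : ∀ y, A →⋆ₐ[ℂ] (G y →L[ℂ] G y)) (a : A) (z : lp G 2) (y : Y) :
    lp.diagRep π a z y = π y a (z y) := rfl

/-- Grouping the summands of a Hilbert sum in pairs. -/
theorem lp.exists_linearIsometryEquiv_pairs {X Y : Type*} {G : X → Type*}
    [∀ x, NormedAddCommGroup (G x)] [∀ x, InnerProductSpace ℂ (G x)] [∀ x, CompleteSpace (G x)]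
    (p q : Y → X) (hp : Function.Injective p) (hq : Function.Injective q)
    (hpq : ∀ y y', p y ≠ q y') (hcover : ∀ x, (∃ y, p y = x) ∨ ∃ y, q y = x) :
    ∃ U : lp G 2 ≃ₗᵢ[ℂ] lp (fun y => WithLp 2 (G (p y) × G (q y))) 2,
      ∀ z y, U z y = WithLp.toLp 2 (z (p y), z (q y)) := by
  classical
  let v : ∀ y, WithLp 2 (G (p y) × G (q y)) →ₗ[ℂ] lp G 2 := fun y =>
    ((lp.lsingle 2 (p y)).coprod (lp.lsingle 2 (q y))) ∘ₗ (WithLp.linearEquiv 2 ℂ _).toLinearMap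
  have hv : ∀ y c, v y c = lp.single 2 (p y) c.fst + lp.single 2 (q y) c.snd := fun _ _ => rfl
  have hinner : ∀ y c z, ⟪v y c, z⟫_ℂ = ⟪c.fst, z (p y)⟫_ℂ + ⟪c.snd, z (q y)⟫_ℂ := fun y c z => by
    rw [hv, inner_add_left, lp.inner_single_left, lp.inner_single_left]
  have hvp : ∀ y c, v y c (p y) = c.fst := fun y c => by
    rw [hv, lp.coeFn_add, Pi.add_apply, lp.single_apply_self, lp.single_apply_ne _ _ _ (hpq y y),
      add_zero]
  have hvq : ∀ y c, v y c (q y) = c.snd := fun y c => by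
    rw [hv, lp.coeFn_add, Pi.add_apply, lp.single_apply_self,
      lp.single_apply_ne _ _ _ (hpq y y).symm, zero_add]
  have hnorm : ∀ y c, ‖v y c‖ = ‖c‖ := fun y c => by
    have h : ⟪v y c, v y c⟫_ℂ = ⟪c, c⟫_ℂ := by
      rw [hinner, hvp, hvq, WithLp.prod_inner_apply]
      rfl
    rw [inner_self_eq_norm_sq_to_K, inner_self_eq_norm_sq_to_K] at h
    exact (sq_eq_sq₀ (norm_nonneg _) (norm_nonneg _)).mp (by exact_mod_cast h)
  let V : ∀ y, WithLp 2 (G (p y) × G (q y)) →ₗᵢ[ℂ] lp G 2 := fun y => ⟨v y, hnorm y⟩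
  have horth : OrthogonalFamily ℂ (fun y => WithLp 2 (G (p y) × G (q y))) V := by
    intro y y' hy c d
    change ⟪v y c, v y' d⟫_ℂ = 0
    rw [hinner, hv, lp.coeFn_add, Pi.add_apply, Pi.add_apply,
      lp.single_apply_ne _ _ _ (hp.ne hy), lp.single_apply_ne _ _ _ (hq.ne hy),
      lp.single_apply_ne _ _ _ (hpq y y'), lp.single_apply_ne _ _ _ (hpq y' y).symm]
    simp
  have hV : IsHilbertSum ℂ (fun y => WithLp 2 (G (p y) × G (q y))) V := by
    -- A vector orthogonal to all pairs has zero coordinate at every `p y` and `q y`, and these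
    -- exhaust `X`.
    refine IsHilbertSum.mk horth (top_le_iff.mpr ?_)
    rw [Submodule.topologicalClosure_eq_top_iff, Submodule.eq_bot_iff]
    intro z hz
    have h : ∀ y c, ⟪v y c, z⟫_ℂ = 0 := fun y c =>
      Submodule.inner_right_of_mem_orthogonal
        (Submodule.mem_iSup_of_mem y (LinearMap.mem_range_self (V y).toLinearMap c)) hz
    refine lp.ext (funext fun x => ?_)
    rcases hcover x with ⟨y, rfl⟩ | ⟨y, rfl⟩
    · have := h y (WithLp.toLp 2 (z (p y), 0))
      rw [hinner] at this
      simpa using this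
    · have := h y (WithLp.toLp 2 (0, z (q y)))
      rw [hinner] at this
      simpa using this
  refine ⟨hV.linearIsometryEquiv, fun z y => ext_inner_left ℂ fun c => ?_⟩
  rw [← lp.inner_single_left (G := fun y => WithLp 2 (G (p y) × G (q y))),
    ← hV.linearIsometryEquiv.symm.inner_map_map, LinearIsometryEquiv.symm_apply_apply,
    hV.linearIsometryEquiv_symm_apply_single]
  refine (hinner y c z).trans ?_
  rw [WithLp.prod_inner_apply]
  rfl

/-- Assembling a representation of `A` on a Hilbert sum of representations of `B` from
representations on pairs of summands. -/
theorem exists_rep_of_pairs {A B : Type u} [CStarAlgebra A] [CStarAlgebra B] (ε : B →⋆ₐ[ℂ] A)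
    {X Y : Type u} (G : X → HilbertRep B) (p q : Y → X) (hp : Function.Injective p)
    (hq : Function.Injective q) (hpq : ∀ y y', p y ≠ q y')
    (hcover : ∀ x, (∃ y, p y = x) ∨ ∃ y, q y = x)
    (π : ∀ y, A →⋆ₐ[ℂ] (WithLp 2 ((G (p y)).space × (G (q y)).space) →L[ℂ]
      WithLp 2 ((G (p y)).space × (G (q y)).space)))
    (hπ : ∀ y b c, π y (ε b) c = WithLp.toLp 2 ((G (p y)).rep b c.fst, (G (q y)).rep b c.snd)) :
    ∃ P : A →⋆ₐ[ℂ] (lp (fun x => (G x).space) 2 →L[ℂ] lp (fun x => (G x).space) 2),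
      (∀ b, P (ε b) = lp.diagRep (fun x => (G x).rep) b) ∧
      ∀ a z y, P a z (p y) = (π y a (WithLp.toLp 2 (z (p y), z (q y)))).fst := by
  obtain ⟨U, hU⟩ := lp.exists_linearIsometryEquiv_pairs (G := fun x => (G x).space)
    p q hp hq hpq hcover
  let P : A →⋆ₐ[ℂ] (lp (fun x => (G x).space) 2 →L[ℂ] lp (fun x => (G x).space) 2) :=
    (lp.diagRep π).conjUnitary U
  have hP : ∀ a z, U (P a z) = lp.diagRep π a (U z) := fun a z => by
    rw [StarAlgHom.conjUnitary_apply, U.apply_symm_apply]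
  refine ⟨P, fun b => ContinuousLinearMap.ext fun z => U.injective (lp.ext (funext fun y => ?_)),
    fun a z y => ?_⟩
  · rw [hP, lp.diagRep_apply, hU, hU, hπ]
    rfl
  · have h := congrArg (fun t => (t y).fst) (hP a z)
    simp only [lp.diagRep_apply, hU] at h
    exact h

end HilbertSum

/-! ### The free dilation over the tree of reduced words. -/

section FreeDilation

variable {I : Type u} {B : Type u} [CStarAlgebra B] {A : I → Type u} [∀ i, CStarAlgebra (A i)]
  {ε : ∀ i, B →⋆ₐ[ℂ] A i} (V₀ : HilbertRep B) (D₀ : ∀ i, RepDilation (ε i) V₀)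
  (D : ∀ i V, RepDilation (ε i) V)

/-- The representations of `B` obtained from `V₀` by iterated dilation along a word, together with
the dilation that is chosen for each of them and each index: `D₀` at the root, `D` elsewhere. -/
noncomputable def dilationTree : List I → Σ V : HilbertRep B, ∀ i, RepDilation (ε i) V
  | [] => ⟨V₀, D₀⟩
  | i :: w => ⟨((dilationTree w).2 i).compl, fun j => D j _⟩

/-- The words without repeated neighbours. -/
abbrev ReducedWord (I : Type u) : Type u := {w : List I // w.IsChain (· ≠ ·)}

/-- The representation of `B` at a reduced word. -/
noncomputable def dilationNode (w : ReducedWord I) : HilbertRep B :=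
  (dilationTree V₀ D₀ D w.1).1

theorem List.IsChain.cons_of_head?_ne {I : Type u} {w : List I} (hw : w.IsChain (· ≠ ·)) {i : I}
    (h : w.head? ≠ some i) : (i :: w).IsChain (· ≠ ·) := by
  cases w with
  | nil => exact List.isChain_singleton _
  | cons j w =>
    refine List.isChain_cons_cons.mpr ⟨fun hij => h ?_, hw⟩
    rw [hij]; rfl

/-- Prefixing a reduced word with a letter other than its first. -/
def ReducedWord.cons (i : I) (y : {w : ReducedWord I // w.1.head? ≠ some i}) : ReducedWord I :=
  ⟨i :: y.1.1, y.1.2.cons_of_head?_ne y.2⟩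

/-- The space of the free dilation: the sum of the spaces at all reduced words. -/
abbrev DilationSum : Type u := lp (fun w => (dilationNode V₀ D₀ D w).space) 2

/-- Each reduced word is either some `y` not beginning with `i` or `i :: y` for a unique such `y`.
On the pair, `A i` acts by the dilation chosen at `y`. If the component at `i :: y` is zero, only
the corner contributes at `y`. -/
theorem exists_free_rep (i : I) :
    ∃ P : A i →⋆ₐ[ℂ] (DilationSum V₀ D₀ D →L[ℂ] DilationSum V₀ D₀ D),
      (∀ b, P (ε i b) = lp.diagRep (fun w => (dilationNode V₀ D₀ D w).rep) b) ∧
      ∀ a z (y : {w : ReducedWord I // w.1.head? ≠ some i}), z (ReducedWord.cons i y) = 0 →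
        P a z y.1 = ((dilationTree V₀ D₀ D y.1.1).2 i).corner a (z y.1) := by
  obtain ⟨P, hP, hPz⟩ := exists_rep_of_pairs (ε i) (dilationNode V₀ D₀ D)
    (Subtype.val : {w : ReducedWord I // w.1.head? ≠ some i} → _) (ReducedWord.cons i)
    Subtype.val_injective
    (fun y y' h => Subtype.ext (Subtype.ext (List.cons.inj (congrArg Subtype.val h)).2))
    (fun y y' h => y.2 (by rw [h]; rfl))
    (fun x => by
      by_cases hx : x.1.head? = some i
      · right
        obtain ⟨w, hw⟩ := x
        cases w with
        | nil => simp at hx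
        | cons j w =>
          obtain rfl : j = i := by simpa using hx
          refine ⟨⟨⟨w, hw.tail⟩, fun h => ?_⟩, rfl⟩
          cases w with
          | nil => simp at h
          | cons k w =>
            obtain rfl : k = j := by simpa using h
            exact (List.isChain_cons_cons.mp hw).1 rfl
      · exact Or.inl ⟨⟨x, hx⟩, rfl⟩)
    (fun y => ((dilationTree V₀ D₀ D y.1.1).2 i).rep)
    (fun y => ((dilationTree V₀ D₀ D y.1.1).2 i).rep_incl)
  refine ⟨P, hP, fun a z y hz => ?_⟩
  rw [hPz, hz]
  rfl

theorem lp.exists_single_isometry {X : Type*} {G : X → Type*} [∀ x, NormedAddCommGroup (G x)]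
    [∀ x, InnerProductSpace ℂ (G x)] (o : X) :
    ∃ S : G o →ₗᵢ[ℂ] lp G 2, (∀ v, S v o = v) ∧ (∀ v x, x ≠ o → S v x = 0) ∧
      ∀ v z, ⟪S v, z⟫_ℂ = ⟪v, z o⟫_ℂ := by
  classical
  exact ⟨⟨lp.lsingle 2 o, fun v => lp.norm_single (by norm_num) o v⟩,
    fun v => lp.single_apply_self 2 o v, fun v x hx => lp.single_apply_ne 2 o v hx,
    fun v z => lp.inner_single_left o v z⟩

/-- The empty word. -/
def ReducedWord.nil : ReducedWord I := ⟨[], List.isChain_nil⟩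

theorem ReducedWord.cons_ne_nil (i : I) (y : {w : ReducedWord I // w.1.head? ≠ some i}) :
    ReducedWord.cons i y ≠ ReducedWord.nil := fun h => by
  cases congrArg Subtype.val h

theorem corner_dilationTree_eq_zero {i : I} {a : A i} (ha : ∀ V v, (D i V).corner a v = 0)
    {x : ReducedWord I} (hx : x ≠ ReducedWord.nil) (v : (dilationNode V₀ D₀ D x).space) :
    ((dilationTree V₀ D₀ D x.1).2 i).corner a v = 0 := by
  obtain ⟨x, hxc⟩ := x
  cases x with
  | nil => exact absurd rfl hx
  | cons j x => exact ha _ _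

/-- The component at the empty word. -/
noncomputable def DilationSum.root (z : DilationSum V₀ D₀ D) : V₀.space := z ReducedWord.nil

theorem root_free_rep (P : ∀ i, A i →⋆ₐ[ℂ] (DilationSum V₀ D₀ D →L[ℂ] DilationSum V₀ D₀ D))
    (hP : ∀ i a z (y : {w : ReducedWord I // w.1.head? ≠ some i}), z (ReducedWord.cons i y) = 0 →
      P i a z y.1 = ((dilationTree V₀ D₀ D y.1.1).2 i).corner a (z y.1))
    (i : I) (a : A i) (z : DilationSum V₀ D₀ D) (hz : ∀ y, z (ReducedWord.cons i y) = 0) :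
    DilationSum.root V₀ D₀ D (P i a z) = (D₀ i).corner a (DilationSum.root V₀ D₀ D z) :=
  hP i a z ⟨ReducedWord.nil, by simp [ReducedWord.nil]⟩ (hz _)

/-- A reduced product maps a vector `z` supported at the empty word to a vector whose component at
the empty word is the product of the corners, and whose other components lie at words which begin
with the first letter of the product. -/
theorem free_rep_prod_apply (P : ∀ i, A i →⋆ₐ[ℂ] (DilationSum V₀ D₀ D →L[ℂ] DilationSum V₀ D₀ D))
    (hP : ∀ i a z (y : {w : ReducedWord I // w.1.head? ≠ some i}), z (ReducedWord.cons i y) = 0 →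
      P i a z y.1 = ((dilationTree V₀ D₀ D y.1.1).2 i).corner a (z y.1))
    (z : DilationSum V₀ D₀ D)
    (hz : ∀ x, x ≠ ReducedWord.nil → z x = 0) (w : List (Σ i, A i))
    (hw : w.IsChain (fun x y => x.1 ≠ y.1)) (hker : ∀ x ∈ w, ∀ V v, (D x.1 V).corner x.2 v = 0) :
    DilationSum.root V₀ D₀ D ((w.map fun t => P t.1 t.2).prod z) =
        (w.map fun t => (D₀ t.1).corner t.2).prod (DilationSum.root V₀ D₀ D z) ∧
      ∀ x : ReducedWord I, x ≠ ReducedWord.nil → x.1.head? ≠ (w.map Sigma.fst).head? →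
        (w.map fun t => P t.1 t.2).prod z x = 0 := by
  induction w with
  | nil => exact ⟨rfl, fun x hx _ => hz x hx⟩
  | cons t w ih =>
    obtain ⟨ih₁, ih₂⟩ := ih hw.tail fun x hx => hker x (List.mem_cons_of_mem _ hx)
    rw [List.map_cons, List.prod_cons, List.map_cons, List.prod_cons, mul_apply_eq_comp,
      mul_apply_eq_comp]
    generalize (w.map fun t => P t.1 t.2).prod z = z' at ih₁ ih₂ ⊢
    -- The components of `z'` off the root lie at words beginning with the next letter, which
    -- differs from `t.1`. So `t` acts on `z'` through corners alone.
    have hcons : ∀ x, z' (ReducedWord.cons t.1 x) = 0 := fun x => by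
      refine ih₂ _ (ReducedWord.cons_ne_nil _ _) ?_
      cases w with
      | nil => simp [ReducedWord.cons]
      | cons t' w => simpa [ReducedWord.cons] using (List.isChain_cons_cons.mp hw).1
    refine ⟨?_, fun x hx hxt => ?_⟩
    · rw [root_free_rep V₀ D₀ D P hP _ _ _ hcons, ih₁]
    · rw [hP t.1 t.2 _ ⟨x, hxt⟩ (hcons _)]
      exact corner_dilationTree_eq_zero V₀ D₀ D (hker t List.mem_cons_self) hx _

/-- The common dilation of the `D₀ i` on one space; a product of elements whose corners vanish in
all dilations other than `D₀` has the product of the corners as its corner. -/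
theorem exists_free_dilation :
    ∃ (K : HilbertRep B) (P : ∀ i, A i →⋆ₐ[ℂ] (K.space →L[ℂ] K.space))
      (S : V₀.space →ₗᵢ[ℂ] K.space),
      (∀ i b, P i (ε i b) = K.rep b) ∧
      (∀ i a x y, ⟪S x, P i a (S y)⟫_ℂ = ⟪x, (D₀ i).corner a y⟫_ℂ) ∧
      ∀ w : List (Σ i, A i), w.IsChain (fun x y => x.1 ≠ y.1) →
        (∀ x ∈ w, ∀ V v, (D x.1 V).corner x.2 v = 0) → ∀ x y,
        ⟪S x, (w.map fun t => P t.1 t.2).prod (S y)⟫_ℂ =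
          ⟪x, (w.map fun t => (D₀ t.1).corner t.2).prod y⟫_ℂ := by
  choose P hPε hP using exists_free_rep V₀ D₀ D
  obtain ⟨S, hSo, hSne, hinner⟩ : ∃ S : V₀.space →ₗᵢ[ℂ] DilationSum V₀ D₀ D,
      (∀ v, DilationSum.root V₀ D₀ D (S v) = v) ∧ (∀ v x, x ≠ ReducedWord.nil → S v x = 0) ∧
        ∀ v z, ⟪S v, z⟫_ℂ = ⟪v, DilationSum.root V₀ D₀ D z⟫_ℂ :=
    lp.exists_single_isometry (G := fun w => (dilationNode V₀ D₀ D w).space) ReducedWord.nil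
  refine ⟨⟨DilationSum V₀ D₀ D, lp.diagRep fun w => (dilationNode V₀ D₀ D w).rep⟩, P, S, hPε,
    fun i a x y => ?_, fun w hw hker x y => ?_⟩
  · rw [hinner, root_free_rep V₀ D₀ D P hP i a _
      fun y' => hSne y _ (ReducedWord.cons_ne_nil _ _), hSo]
  · rw [hinner, (free_rep_prod_apply V₀ D₀ D P hP (S y) (hSne y) w hw hker).1, hSo]

end FreeDilation

/-! ### Compression to the root. -/

/-- Boca's theorem for a C⋆-algebra with the lifting property of the amalgamated free product. -/
theorem exists_ucp_of_lift {I : Type u} (J : Set I)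
    {B : Type u} [CStarAlgebra B] [PartialOrder B] [StarOrderedRing B]
    {A : I → Type u} [∀ i, CStarAlgebra (A i)] [∀ i, PartialOrder (A i)]
    [∀ i, StarOrderedRing (A i)]
    (ε : ∀ i, B →⋆ₐ[ℂ] A i) (hε : ∀ i, Function.Injective (ε i))
    {F : Type*} [CStarAlgebra F]
    [PartialOrder F] [StarOrderedRing F] (ι : ∀ i, A i →⋆ₐ[ℂ] F)
    (lift : ∀ (K : HilbertRep B) [Nontrivial K.space]
      (P : ∀ i, A i →⋆ₐ[ℂ] (K.space →L[ℂ] K.space)), (∀ i b, P i (ε i b) = K.rep b) →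
      ∃ τ : F →⋆ₐ[ℂ] (K.space →L[ℂ] K.space), ∀ i a, τ (ι i a) = P i a)
    (E : ∀ j : J, ConditionalExpectation (ε j))
    (V₀ : HilbertRep B)
    (Φ : ∀ i, A i →CP (V₀.space →L[ℂ] V₀.space))
    (hΦε : ∀ i b, Φ i (ε i b) = V₀.rep b) :
    ∃ Ψ : F →CP (V₀.space →L[ℂ] V₀.space),
      Ψ 1 = 1 ∧
      (∀ i a, Ψ (ι i a) = Φ i a) ∧
      ∀ w : List (Σ j : J, A j),
        w.IsChain (fun x y => x.1 ≠ y.1) →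
        (∀ x ∈ w, (E x.1).toLinearMap x.2 = 0) →
        Ψ (w.map fun x => ι x.1 x.2).prod =
          (w.map fun x => Φ x.1 x.2).prod := by
  -- The lifting property is available only on nonzero spaces. On the zero space the zero map is
  -- unital.
  rcases subsingleton_or_nontrivial V₀.space with hH | hH
  · refine ⟨⟨0, fun k M _ => ?_⟩, ContinuousLinearMap.ext fun x => Subsingleton.elim _ _,
      fun i a => ContinuousLinearMap.ext fun x => Subsingleton.elim _ _,
      fun w _ _ => ContinuousLinearMap.ext fun x => Subsingleton.elim _ _⟩
    refine le_of_eq (CStarMatrix.ext fun s t => ?_)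
    exact ContinuousLinearMap.ext fun x => Subsingleton.elim _ _
  choose D₀ hD₀ using fun i =>
    CompletelyPositiveMap.exists_dilation (ε := ε i) (V := V₀) (Φ i) (hΦε i)
  -- The vanishing of corners is stated conditionally on `i ∈ J`, so that one choice of dilations
  -- covers all indices.
  have hD : ∀ i (V : HilbertRep B), ∃ D : RepDilation (ε i) V, ∀ hi : i ∈ J, ∀ a,
      (E ⟨i, hi⟩).toLinearMap a = 0 → ∀ x, D.corner a x = 0 := fun i V => by
    by_cases hi : i ∈ J
    · obtain ⟨D, hD⟩ := (E ⟨i, hi⟩).exists_dilation V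
      exact ⟨D, fun _ => hD⟩
    · exact ⟨(V.nonempty_dilation (hε i)).some, fun h => absurd h hi⟩
  choose D hD using hD
  obtain ⟨K, P, S, hPε, hPcorner, hPprod⟩ := exists_free_dilation V₀ D₀ D
  have : Nontrivial K.space := S.injective.nontrivial
  obtain ⟨τ, hτ⟩ := lift K P hPε
  have hcorner : ∀ i a, (D₀ i).corner a = Φ i a := fun i a => ContinuousLinearMap.ext (hD₀ i a)
  have hΨ : ∀ x y h, ⟪h, CompletelyPositiveMap.compression τ
      S.toContinuousLinearMap x y⟫_ℂ = ⟪S h, τ x (S y)⟫_ℂ := fun x y h =>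
    CompletelyPositiveMap.inner_compression τ S.toContinuousLinearMap x h y
  refine ⟨CompletelyPositiveMap.compression τ S.toContinuousLinearMap,
    ?_, fun i a => ?_, fun w hw hker => ?_⟩
  · refine ContinuousLinearMap.ext fun y => ext_inner_left ℂ fun h => ?_
    rw [hΨ, map_one]
    exact S.inner_map_map _ _
  · refine ContinuousLinearMap.ext fun y => ext_inner_left ℂ fun h => ?_
    rw [hΨ, ← hcorner, hτ]
    exact hPcorner i a h y
  · refine ContinuousLinearMap.ext fun y => ext_inner_left ℂ fun h => ?_
    have hw' := hPprod (w.map fun x => ⟨x.1, x.2⟩)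
      ((List.isChain_map _).mpr (hw.imp fun x y hxy h => hxy (Subtype.ext h)))
      (fun x hx V v => by
        obtain ⟨x, hxw, rfl⟩ := List.mem_map.mp hx
        exact hD _ _ x.1.2 _ (hker x hxw) v) h y
    rw [hΨ, map_list_prod, List.map_map]
    rw [List.map_map, List.map_map] at hw'
    simp only [Function.comp_def, hτ]
    refine hw'.trans ?_
    simp only [Function.comp_def, hcorner]

end AmalgamatedDilation

theorem theorem3p4 {I : Type u} (J : Set I)
    {B : Type u} [CStarAlgebra B] [PartialOrder B] [StarOrderedRing B]
    {A : I → Type u} [∀ i, CStarAlgebra (A i)] [∀ i, PartialOrder (A i)]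
    [∀ i, StarOrderedRing (A i)]
    (ε : ∀ i, B →⋆ₐ[ℂ] A i) (hε : ∀ i, Function.Injective (ε i))
    (E : ∀ j : J, ConditionalExpectation (ε j))
    {H : Type u} [NormedAddCommGroup H] [InnerProductSpace ℂ H] [CompleteSpace H]
    (Φ : ∀ i, A i →CP (H →L[ℂ] H)) (hΦ : ∀ i, Φ i 1 = 1)
    (ρ : B →⋆ₐ[ℂ] (H →L[ℂ] H)) (hρ : ∀ i b, Φ i (ε i b) = ρ b) :
    ∃ Ψ : AmalgFreeProduct ε →CP (H →L[ℂ] H),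
      Ψ 1 = 1 ∧
      (∀ i a, Ψ (AmalgFreeProduct.of ε i a) = Φ i a) ∧
      ∀ w : List (Σ j : J, A j),
        w.IsChain (fun x y => x.1 ≠ y.1) →
        (∀ x ∈ w, (E x.1).toLinearMap x.2 = 0) →
        Ψ (w.map fun x => AmalgFreeProduct.of ε x.1 x.2).prod =
          (w.map fun x => Φ x.1 x.2).prod := by
  exact exists_ucp_of_lift J ε hε (AmalgFreeProduct.of ε) (fun K _ P hP => by
    obtain ⟨τ, hτ, -⟩ := AmalgFreeProduct.exists_lift ε K.rep P hP
    exact ⟨τ, hτ⟩) E ⟨H, ρ⟩ Φ hρ
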